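/- All logarithms are to base $2$. Let $D$ be a probability distribution on a finite set $\Omega$ with $m=\log|\Omega|\ge 2$, and let $H(D)=\sum_{x\in\Omega}D(x)\log\frac1{D(x)}$ (with $0\log\frac10=0$) be its Shannon entropy. A probability-revealing conditional sampling oracle $\mathsf{PROC}$ for $D$, queried with a set $S\subseteq\Omega$ with $D(S)=\sum_{y\in S}D(y)>0$, returns, independently of everything before, a pair $(x,D(x))$ with $x\in S$, where $x$ is drawn with probability $D(x)/D(S)$; its answers to queries $S$ with $D(S)=0$ may be arbitrary. The subroutine $\mathsf{SampleEst}(\bar S,t,\delta)$, for $\bar S\subseteq\Omega$ and $t\in\mathbb N$, repeats the following $\lceil\frac92\log\frac2\delta\rceil$ times: query $\mathsf{PROC}(\Omega\setminus\bar S)$ $t$ times and record the mean of the $t$ values $\log(1/r)$, where $(y,r)$ are the answers. It returns the median of the recorded means. The algorithm $\mathsf{EntropyEstimation}(\varepsilon,\delta)$ performs at most $\lceil\log(10/\delta)\rceil$ rounds. In each round it queries $(x,r)\gets\mathsf{PROC}(\Omega)$, and if $r>\frac12$ it stops and returns $\hat h=(1-r)\,\hat h_{rem}+r\log\frac1r$,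 where $\hat h_{rem}=\mathsf{SampleEst}(\{x\},t_1,0.9\,\delta)$ and $t_1=\left\lceil\frac6{\varepsilon^2}\left(m+\log(m+\log m+2.5)\right)\right\rceil$. If no round had $r>\frac12$, it returns $\hat h=\mathsf{SampleEst}(\varnothing,t_0,0.9\,\delta)$, where $t_0=\left\lceil\frac6{\varepsilon^2}\left(m+\log(m+\log m+1.1)-1\right)\right\rceil$. **Theorem.** For every tolerance parameter $\varepsilon>0$ and confidence parameter $\delta>0$, the value $\hat h$ returned by $\mathsf{EntropyEstimation}(\varepsilon,\delta)$ satisfies $$\Pr\left[(1-\varepsilon)H(D)\le\hat h\le(1+\varepsilon)H(D)\right]\ge 1-\delta .$$ Whatever the answers of the oracle, the algorithm makes at most $$\left\lceil\log\tfrac{10}{\delta}\right\rceil^+ +\left\lceil\tfrac92\log\tfrac{2}{0.9\,\delta}\right\rceil^+\cdot\left\lceil\tfrac6{\varepsilon^2}\left(m+\log(m+\log m+2.5)\right)\right\rceil$$ queries, where $\lceil a\rceil^+=\max(\lceil a\rceil,0)$. In particular, for $\varepsilon\le1$ and $\delta\le\frac12$ it makes at most $160\,\frac{m}{\varepsilon^2}\log\frac1\delta$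 queries, so $O\!\left(\frac m{\varepsilon^2}\log\frac1\delta\right)$. -/

import Mathlib

/-!
Programs with access to a probability-revealing conditional sampling oracle, and the
median-of-means entropy estimator. All logarithms are to base 2.
-/

namespace EntropyEst

noncomputable section

/-- A (deterministic, adaptive) program over the domain `Ω` with output in `α`. Its only access to
the unknown distribution is through oracle queries: it submits a set `S`, receives an answer
`(x, r)`, and continues depending on that answer. -/
inductive Program (Ω : Type*) (α : Type*) where
  | ret (a : α) : Program Ω α
  | query (S : Finset Ω) (next : Ω × ℝ → Program Ω α) : Program Ω α

namespace Program

variable {Ω α β : Type*}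

/-- Sequential composition. -/
def bind : Program Ω α → (α → Program Ω β) → Program Ω β
  | ret a, f => f a
  | query S next, f => query S fun a => (next a).bind f

/-- Run the program `n` times in a row and list the `n` results. -/
def repeated (p : Program Ω α) : ℕ → Program Ω (List α)
  | 0 => ret []
  | n + 1 => p.bind fun a => (p.repeated n).bind fun l => ret (a :: l)

/-- The output distribution of a program when every query `S` is answered by a fresh, independent
draw from `oracle S`. -/
def run (oracle : Finset Ω → PMF (Ω × ℝ)) : Program Ω α → PMF α
  | ret a => PMF.pure a
  | query S next => (oracle S).bind fun a => (next a).run oracle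

/-- The program makes at most `n` queries, whatever the answers are. -/
def QueriesAtMost : Program Ω α → ℕ → Prop
  | ret _, _ => True
  | query _ _, 0 => False
  | query _ next, n + 1 => ∀ a, (next a).QueriesAtMost n

end Program

/-- `oracle` is a probability-revealing conditional sampling oracle for `D`: on a query `S` of
positive mass it answers `(x, D x)` with `x ∈ S` drawn with probability `D x / ∑ y ∈ S, D y`.
Conditioning on a set of mass zero is meaningless, and the answer to such a query is arbitrary. -/
def IsPROC {Ω : Type*} [DecidableEq Ω] (D : PMF Ω) (oracle : Finset Ω → PMF (Ω × ℝ)) : Prop :=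
  ∀ S : Finset Ω, ∑ y ∈ S, D y ≠ 0 → ∀ (x : Ω) (r : ℝ),
    oracle S (x, r) = if x ∈ S ∧ r = (D x).toReal then D x / ∑ y ∈ S, D y else 0

/-- The Shannon entropy, in bits. -/
def entropy {Ω : Type*} [Fintype Ω] (D : PMF Ω) : ℝ :=
  ∑ x, (D x).toReal * Real.logb 2 (1 / (D x).toReal)

/-- The median of a list: the middle entry of the sorted list, or the mean of the two middle
entries if the length is even (and `0` for the empty list). -/
def median (l : List ℝ) : ℝ :=
  ((l.mergeSort).getD ((l.length - 1) / 2) 0 + (l.mergeSort).getD (l.length / 2) 0) / 2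

section Algorithm

variable (Ω : Type*) [Fintype Ω]

/-- The bit length `m = log |Ω|` of the domain. -/
def bitLength : ℝ := Real.logb 2 (Fintype.card Ω)

/-- Number of rounds of the search for an element of mass above `1/2`. -/
def searchRounds (δ : ℝ) : ℕ := ⌈Real.logb 2 (10 / δ)⌉₊

/-- Number of batches whose means enter the median. -/
def batchCount (δ : ℝ) : ℕ := ⌈9 / 2 * Real.logb 2 (2 / δ)⌉₊

/-- Batch size after an element of mass above `1/2` has been found. -/
def batchSizeHeavy (ε : ℝ) : ℕ :=
  ⌈6 / ε ^ 2 * (bitLength Ω + Real.logb 2 (bitLength Ω + Real.logb 2 (bitLength Ω) + 2.5))⌉₊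

/-- Batch size when no element of mass above `1/2` has been found. -/
def batchSizeLight (ε : ℝ) : ℕ :=
  ⌈6 / ε ^ 2 *
    (bitLength Ω + Real.logb 2 (bitLength Ω + Real.logb 2 (bitLength Ω) + 1.1) - 1)⌉₊

variable {Ω} [DecidableEq Ω]

/-- Query the complement of `Sbar` once and output `log (1 / r)` for the answer `(y, r)`. -/
def drawSelfInfo (Sbar : Finset Ω) : Program Ω ℝ :=
  .query (Finset.univ \ Sbar) fun a => .ret (Real.logb 2 (1 / a.2))

/-- The mean of `t` draws of the self-information outside `Sbar`. -/
def batchMean (Sbar : Finset Ω) (t : ℕ) : Program Ω ℝ :=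
  ((drawSelfInfo Sbar).repeated t).bind fun l => .ret (l.sum / t)

/-- The subroutine `SampleEst`: the median of `⌈9/2 log (2/δ)⌉` means of `t` draws each. -/
def sampleEst (Sbar : Finset Ω) (t : ℕ) (δ : ℝ) : Program Ω ℝ :=
  ((batchMean Sbar t).repeated (batchCount δ)).bind fun l => .ret (median l)

/-- The main loop, with the given number of search rounds left: sample from all of `Ω`; as soon as
an answer `(x, r)` has `r > 1/2`, estimate by conditioning on avoiding `x`; if the rounds are used
up, estimate from unconditional samples. -/
def searchLoop (ε δ : ℝ) : ℕ → Program Ω ℝ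
  | 0 => sampleEst ∅ (batchSizeLight Ω ε) (0.9 * δ)
  | k + 1 => .query Finset.univ fun a =>
      if a.2 > 1 / 2 then
        (sampleEst {a.1} (batchSizeHeavy Ω ε) (0.9 * δ)).bind fun h =>
          .ret ((1 - a.2) * h + a.2 * Real.logb 2 (1 / a.2))
      else searchLoop ε δ k

variable (Ω) in
/-- The algorithm `EntropyEstimation`. -/
def entropyEstimation (ε δ : ℝ) : Program Ω ℝ := searchLoop ε δ (searchRounds δ)

end Algorithm

end

end EntropyEst

open scoped ENNReal

namespace EntropyEst

/-! The oracle reveals masses, so each draw is an exact sample of Z = log (1 / D x), whose mean is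
the entropy. By Chebyshev, the batch size is governed by Var Z / (𝔼 Z)², and the core of the proof
is that this ratio is at most about m.

If no mass exceeds 1/2, then Z ≥ 1, and 𝔼 2 ^ Z counts the support, hence is at most 2 ^ m.
`sum_sq_le_of_sum_two_rpow_le` turns these two facts into 𝔼 Z² ≤ (m + 2) (𝔼 Z)². A point x of mass
above 1/2 destroys Z ≥ 1, so D is conditioned on avoiding x. There the shift Z + log (2 (1 - D x))
is again at least 1, with exponential moment at most 2 ^ (m + 1). The contribution of x to the
entropy is known exactly and is nonnegative, so adding it does not worsen the relative error
(`expect_estimate_avoiding_le`).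

A batch mean thus fails with probability at most 1/6, and the median of the batches with probability
at most 0.45 δ (`expect_median_notMem_le`). The search misses a heavy point with probability at most
δ / 10 (`half_pow_searchRounds_le`). Query counts follow by structural recursion on programs. -/

/-- The expectation of an `ℝ≥0∞`-valued function under a probability mass function. -/
noncomputable def expect {α : Type*} (p : PMF α) (f : α → ℝ≥0∞) : ℝ≥0∞ := ∑' a, p a * f a

/-! ### Expectations under probability mass functions -/

section Expect

variable {α β : Type*}

lemma expect_pure (a : α) (f : α → ℝ≥0∞) : expect (PMF.pure a) f = f a := by
  unfold expect
  rw [tsum_eq_single a]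
  · simp
  · intro b hb
    simp [PMF.pure_apply, hb]

lemma expect_bind (p : PMF α) (q : α → PMF β) (f : β → ℝ≥0∞) :
    expect (p.bind q) f = expect p fun a => expect (q a) f := by
  simp only [expect, PMF.bind_apply, ← ENNReal.tsum_mul_right, ← ENNReal.tsum_mul_left]
  rw [ENNReal.tsum_comm]
  simp only [mul_assoc]

lemma expect_mono (p : PMF α) {f g : α → ℝ≥0∞} (h : ∀ a, f a ≤ g a) :
    expect p f ≤ expect p g :=
  ENNReal.tsum_le_tsum fun a => by gcongr; exact h a

lemma expect_const (p : PMF α) (c : ℝ≥0∞) : expect p (fun _ => c) = c := by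
  simp [expect, ENNReal.tsum_mul_right, p.tsum_coe]

lemma expect_mul_right (p : PMF α) (f : α → ℝ≥0∞) (c : ℝ≥0∞) :
    expect p (fun a => f a * c) = expect p f * c := by
  simp [expect, ENNReal.tsum_mul_right, ← mul_assoc]

lemma expect_indicator_le_one (p : PMF α) (s : Set α) : expect p (s.indicator 1) ≤ 1 := by
  refine (expect_mono p (g := fun _ => 1) fun a => ?_).trans_eq (expect_const p 1)
  exact Set.indicator_le_self' (by simp) a

/-- Markov's inequality. -/
lemma expect_indicator_le_div (p : PMF α) (s : Set α) (f : α → ℝ≥0∞) {c : ℝ≥0∞} (hc : c ≠ 0)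
    (hc' : c ≠ ∞) (h : ∀ a ∈ s, c ≤ f a) : expect p (s.indicator 1) ≤ expect p f / c := by
  rw [ENNReal.le_div_iff_mul_le (.inl hc) (.inl hc'), ← expect_mul_right]
  refine expect_mono p fun a => ?_
  by_cases ha : a ∈ s <;> simp [ha, h]

lemma toMeasure_real_ge_of_expect_le (p : PMF ℝ) {s : Set ℝ} (hs : MeasurableSet s) {δ : ℝ}
    (hδ : 0 ≤ δ) (h : expect p (sᶜ.indicator 1) ≤ ENNReal.ofReal δ) :
    p.toMeasure.real s ≥ 1 - δ := by
  have h1 : p.toMeasure sᶜ = expect p (sᶜ.indicator 1) := by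
    rw [PMF.toMeasure_apply _ hs.compl, expect]
    refine tsum_congr fun a => ?_
    by_cases ha : a ∈ s <;> simp [ha]
  have h2 : p.toMeasure.real sᶜ ≤ δ := by
    rw [MeasureTheory.measureReal_def, h1]
    exact ENNReal.toReal_le_of_le_ofReal hδ h
  have h3 := MeasureTheory.probReal_compl_eq_one_sub (μ := p.toMeasure) hs
  linarith

end Expect

/-! ### Expectations and query counts of composed programs -/

namespace Program

variable {Ω α β : Type*}

lemma run_bind (oracle : Finset Ω → PMF (Ω × ℝ)) (p : Program Ω α) (f : α → Program Ω β) :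
    (p.bind f).run oracle = (p.run oracle).bind fun a => (f a).run oracle := by
  induction p with
  | ret a => simp [bind, run]
  | query S next ih => simp [bind, run, ih, PMF.bind_bind]

lemma expect_run_bind (oracle : Finset Ω → PMF (Ω × ℝ)) (p : Program Ω α) (f : α → Program Ω β)
    (g : β → ℝ≥0∞) :
    expect ((p.bind f).run oracle) g
      = expect (p.run oracle) fun a => expect ((f a).run oracle) g := by
  rw [run_bind, expect_bind]

lemma expect_run_bind_ret (oracle : Finset Ω → PMF (Ω × ℝ)) (p : Program Ω α) (f : α → β)
    (g : β → ℝ≥0∞) :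
    expect ((p.bind fun a => ret (f a)).run oracle) g
      = expect (p.run oracle) fun a => g (f a) := by
  simp [expect_run_bind, run, expect_pure]

lemma expect_run_repeated_zero (oracle : Finset Ω → PMF (Ω × ℝ)) (p : Program Ω α)
    (g : List α → ℝ≥0∞) : expect ((p.repeated 0).run oracle) g = g [] :=
  expect_pure _ _

lemma expect_run_repeated_succ (oracle : Finset Ω → PMF (Ω × ℝ)) (p : Program Ω α) (n : ℕ)
    (g : List α → ℝ≥0∞) :
    expect ((p.repeated (n + 1)).run oracle) g
      = expect (p.run oracle) fun a =>
          expect ((p.repeated n).run oracle) fun l => g (a :: l) := by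
  rw [repeated, expect_run_bind]
  simp only [expect_run_bind_ret]

/-- Lists of any other length have probability zero, so the number of repetitions may be used as the
length of the result. -/
lemma expect_run_repeated_congr (oracle : Finset Ω → PMF (Ω × ℝ)) (p : Program Ω α) (n : ℕ)
    {g g' : List α → ℝ≥0∞} (h : ∀ l : List α, l.length = n → g l = g' l) :
    expect ((p.repeated n).run oracle) g = expect ((p.repeated n).run oracle) g' := by
  induction n generalizing g g' with
  | zero => simpa only [expect_run_repeated_zero] using h [] rfl
  | succ n ih =>
    simp only [expect_run_repeated_succ]
    exact congrArg _ (funext fun a => ih fun l hl => h _ (by simp [hl]))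

lemma QueriesAtMost.mono {p : Program Ω α} {n k : ℕ} (h : p.QueriesAtMost n) (hnk : n ≤ k) :
    p.QueriesAtMost k := by
  induction p generalizing n k with
  | ret a => cases k <;> trivial
  | query S next ih =>
    cases n with
    | zero => exact h.elim
    | succ n =>
      obtain ⟨k, rfl⟩ : ∃ j, k = j + 1 := ⟨k - 1, by omega⟩
      exact fun a => ih a (h a) (by omega)

lemma queriesAtMost_ret (a : α) (n : ℕ) : (ret a : Program Ω α).QueriesAtMost n := by
  cases n <;> trivial

lemma QueriesAtMost.bind {p : Program Ω α} {f : α → Program Ω β} {n k : ℕ}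
    (h : p.QueriesAtMost n) (hf : ∀ a, (f a).QueriesAtMost k) :
    (p.bind f).QueriesAtMost (n + k) := by
  induction p generalizing n with
  | ret a => exact (hf a).mono (by omega)
  | query S next ih =>
    cases n with
    | zero => exact h.elim
    | succ n =>
      rw [Nat.add_right_comm]
      exact fun a => ih a (h a)

lemma QueriesAtMost.repeated {p : Program Ω α} {n : ℕ} (h : p.QueriesAtMost n) (k : ℕ) :
    (p.repeated k).QueriesAtMost (k * n) := by
  induction k with
  | zero => exact queriesAtMost_ret _ _
  | succ k ih =>
    rw [Nat.succ_mul, Nat.add_comm (k * n)]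
    exact h.bind fun a => ih.bind (k := 0) fun l => queriesAtMost_ret _ _

end Program

/-! ### Query count of the algorithm -/

section QueryCount

variable {Ω : Type*} [Fintype Ω] [DecidableEq Ω]

lemma sampleEst_queriesAtMost (Sbar : Finset Ω) (t : ℕ) (δ : ℝ) :
    (sampleEst Sbar t δ).QueriesAtMost (batchCount δ * t) := by
  have h1 : (drawSelfInfo Sbar).QueriesAtMost 1 := fun a => Program.queriesAtMost_ret _ _
  have h2 : (batchMean Sbar t).QueriesAtMost (t * 1 + 0) :=
    (h1.repeated t).bind fun l => Program.queriesAtMost_ret _ _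
  rw [mul_one, add_zero] at h2
  exact (h2.repeated _).bind (k := 0) fun l => Program.queriesAtMost_ret _ _

/-- Every path ends in exactly one call of `sampleEst`, with the light or the heavy batch size; the
hypothesis lets the heavy one bound both. -/
lemma searchLoop_queriesAtMost (ε δ : ℝ) (h : batchSizeLight Ω ε ≤ batchSizeHeavy Ω ε) (k : ℕ) :
    (searchLoop (Ω := Ω) ε δ k).QueriesAtMost
      (k + batchCount (0.9 * δ) * batchSizeHeavy Ω ε) := by
  induction k with
  | zero =>
    rw [Nat.zero_add]
    exact (sampleEst_queriesAtMost _ _ _).mono (Nat.mul_le_mul_left _ h)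
  | succ k ih =>
    rw [Nat.add_right_comm]
    intro a
    dsimp only
    split_ifs
    · exact ((sampleEst_queriesAtMost _ _ _).bind (k := 0)
        fun _ => Program.queriesAtMost_ret _ _).mono (by omega)
    · exact ih

end QueryCount

/-! ### Amplification by the median -/

section Median

/-- In the sorted list, a middle entry above `b` forces all later entries above `b`, and one below
`a` forces all earlier entries below `a`. Either way at least half of the entries are outside. -/
lemma median_mem_Icc {a b : ℝ} {l : List ℝ}
    (h : 2 * l.countP (fun x => decide (x ∉ Set.Icc a b)) < l.length) :
    median l ∈ Set.Icc a b := by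
  set l' := l.mergeSort with hl'
  have hperm : l'.Perm l := List.mergeSort_perm _ _
  have hlen : l'.length = l.length := hperm.length_eq
  have hsort : l'.Pairwise (· ≤ ·) := by
    have := List.pairwise_mergeSort (le := fun a b : ℝ => decide (a ≤ b))
      (fun a b c h1 h2 => by simp at *; linarith) (fun a b => by simpa using le_total a b) l
    simpa using this
  rw [← hperm.countP_eq, ← hlen] at h
  have hmono : ∀ i j : ℕ, (hij : i ≤ j) → (hj : j < l'.length) → l'[i]'(by omega) ≤ l'[j] := by
    intro i j hij hj
    rcases hij.eq_or_lt with rfl | hij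
    · exact le_rfl
    · exact List.pairwise_iff_getElem.1 hsort i j (by omega) hj hij
  have hge : ∀ i : ℕ, i < l'.length → 2 * i ≤ l'.length → ∀ hi : i < l'.length, l'[i] ≤ b := by
    intro i _ h2 hi
    by_contra! hb
    have h3 : (l'.drop i).countP (fun x => decide (x ∉ Set.Icc a b)) = (l'.drop i).length := by
      rw [List.countP_eq_length]
      intro x hx
      obtain ⟨j, hj, rfl⟩ := List.getElem_of_mem hx
      rw [List.length_drop] at hj
      have := hmono i (i + j) (by omega) (by omega)
      simp only [List.getElem_drop, Set.mem_Icc, decide_eq_true_eq, not_and, not_le]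
      intro; linarith
    have h4 := (List.drop_sublist i l').countP_le (p := fun x => decide (x ∉ Set.Icc a b))
    rw [List.length_drop] at h3
    omega
  have hle : ∀ i : ℕ, l'.length ≤ 2 * (i + 1) → ∀ hi : i < l'.length, a ≤ l'[i] := by
    intro i h2 hi
    by_contra! hb
    have h3 : (l'.take (i + 1)).countP (fun x => decide (x ∉ Set.Icc a b))
        = (l'.take (i + 1)).length := by
      rw [List.countP_eq_length]
      intro x hx
      obtain ⟨j, hj, rfl⟩ := List.getElem_of_mem hx
      rw [List.length_take] at hj
      have := hmono j i (by omega) (by omega)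
      simp only [List.getElem_take, Set.mem_Icc, decide_eq_true_eq, not_and, not_le]
      intro; linarith
    have h4 := (List.take_sublist (i + 1) l').countP_le (p := fun x => decide (x ∉ Set.Icc a b))
    rw [List.length_take] at h3
    omega
  have hp : 0 < l'.length := by omega
  have e1 : (l'.length - 1) / 2 < l'.length := by omega
  have e2 : l'.length / 2 < l'.length := by omega
  rw [median, ← hl', ← hlen, List.getD_eq_getElem _ _ e1, List.getD_eq_getElem _ _ e2]
  have a1 := hge _ e1 (by omega) e1
  have a2 := hge _ e2 (by omega) e2
  have a3 := hle _ (by omega) e1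
  have a4 := hle _ (by omega) e2
  constructor <;> linarith

/-- An exponential moment in place of a binomial tail: each independent run contributes a factor at
most 1 + (4 - 1) / 6 = 3/2. -/
lemma expect_four_pow_countP_le {Ω α : Type*} (oracle : Finset Ω → PMF (Ω × ℝ))
    (p : Program Ω α) (s : Set α) [DecidablePred (· ∈ s)]
    (h : expect (p.run oracle) (s.indicator 1) ≤ 1 / 6) (n : ℕ) :
    expect ((p.repeated n).run oracle) (fun l => 4 ^ l.countP (fun x => decide (x ∈ s)))
      ≤ ENNReal.ofReal ((3 / 2) ^ n) := by
  induction n with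
  | zero => simp [Program.expect_run_repeated_zero]
  | succ n ih =>
    rw [Program.expect_run_repeated_succ]
    have h1 : ∀ a : α, (expect ((p.repeated n).run oracle)
        fun l => (4 : ℝ≥0∞) ^ (a :: l).countP (fun x => decide (x ∈ s)))
        ≤ (1 + s.indicator 1 a * 3) * ENNReal.ofReal ((3 / 2) ^ n) := by
      intro a
      by_cases ha : a ∈ s
      · simp only [List.countP_cons, ha, decide_true, if_true, pow_succ, expect_mul_right,
          Set.indicator_of_mem, Pi.one_apply]
        rw [mul_comm]
        gcongr
        norm_num
      · simpa [List.countP_cons, ha] using ih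
    refine (expect_mono _ h1).trans ?_
    rw [expect_mul_right, pow_succ', ENNReal.ofReal_mul (by norm_num)]
    gcongr
    have h2 : expect (p.run oracle) (fun a => 1 + s.indicator 1 a * 3)
        = 1 + expect (p.run oracle) (s.indicator 1) * 3 := by
      rw [← expect_mul_right]
      simp only [expect, mul_add, mul_one, ENNReal.tsum_add, PMF.tsum_coe]
    rw [h2]
    calc 1 + expect (p.run oracle) (s.indicator 1) * 3 ≤ 1 + 1 / 6 * 3 := by gcongr
      _ = ENNReal.ofReal (3 / 2) := by
        have : (1 : ℝ≥0∞) + 1 / 6 * 3 = ENNReal.ofReal (1 + 1 / 6 * 3) := by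
          rw [ENNReal.ofReal_add (by norm_num) (by norm_num), ENNReal.ofReal_mul (by norm_num),
            ENNReal.ofReal_div_of_pos (by norm_num)]
          simp
        rw [this]; norm_num

/-- The factor 9/2 in the batch count comes from (3/4) ^ (9/2) ≤ 1/2. -/
lemma three_quarters_pow_batchCount_le {δ : ℝ} (hδ : 0 < δ) (hδ2 : δ ≤ 2) :
    (3 / 4 : ℝ) ^ batchCount δ ≤ δ / 2 := by
  have hlog : 0 ≤ Real.logb 2 (2 / δ) :=
    Real.logb_nonneg (by norm_num) (by rw [le_div_iff₀ hδ]; linarith)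
  have hceil : 9 / 2 * Real.logb 2 (2 / δ) ≤ batchCount δ := Nat.le_ceil _
  have hpow : ((3 / 4 : ℝ) ^ (9 / 2 : ℝ)) ≤ 1 / 2 := by
    have : ((3 / 4 : ℝ) ^ (9 / 2 : ℝ)) ^ 2 ≤ (1 / 2) ^ 2 := by
      rw [← Real.rpow_natCast, ← Real.rpow_mul (by norm_num)]
      norm_num
    exact (pow_le_pow_iff_left₀ (by positivity) (by norm_num) two_ne_zero).1 this
  calc (3 / 4 : ℝ) ^ batchCount δ = (3 / 4 : ℝ) ^ (batchCount δ : ℝ) := by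
        rw [Real.rpow_natCast]
    _ ≤ (3 / 4 : ℝ) ^ (9 / 2 * Real.logb 2 (2 / δ)) :=
        Real.rpow_le_rpow_of_exponent_ge (by norm_num) (by norm_num) hceil
    _ = ((3 / 4 : ℝ) ^ (9 / 2 : ℝ)) ^ Real.logb 2 (2 / δ) := Real.rpow_mul (by norm_num) _ _
    _ ≤ (1 / 2) ^ Real.logb 2 (2 / δ) := by gcongr
    _ = δ / 2 := by
        rw [one_div, Real.inv_rpow (by norm_num), Real.rpow_logb (by norm_num) (by norm_num)
          (by positivity), inv_div]

/-- The median trick: medians of values that leave `[a, b]` with probability at most `1/6`. -/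
lemma expect_median_notMem_le {Ω : Type*} (oracle : Finset Ω → PMF (Ω × ℝ)) (p : Program Ω ℝ)
    {a b δ : ℝ} (hδ : 0 < δ) (hδ2 : δ ≤ 2)
    (h : expect (p.run oracle) ((Set.Icc a b)ᶜ.indicator 1) ≤ 1 / 6) :
    expect (((p.repeated (batchCount δ)).bind fun l => .ret (median l)).run oracle)
      ((Set.Icc a b)ᶜ.indicator 1) ≤ ENNReal.ofReal (δ / 2) := by
  classical
  set T := batchCount δ
  rw [Program.expect_run_bind_ret]
  have h1 : expect ((p.repeated T).run oracle)
      (fun l => (Set.Icc a b)ᶜ.indicator (1 : ℝ → ℝ≥0∞) (median l))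
      = expect ((p.repeated T).run oracle)
        ({l : List ℝ | l.length = T ∧ median l ∈ (Set.Icc a b)ᶜ}.indicator 1) := by
    refine Program.expect_run_repeated_congr _ _ _ fun l hl => ?_
    by_cases hm : median l ∈ (Set.Icc a b)ᶜ
    · rw [Set.indicator_of_mem hm, Set.indicator_of_mem (by exact ⟨hl, hm⟩)]; simp
    · rw [Set.indicator_of_notMem hm, Set.indicator_of_notMem fun h => hm h.2]
  rw [h1]
  -- If the median is outside, at least `T / 2` values are, so 4 ^ count ≥ 2 ^ T. Markov then gives
  -- (3/2) ^ T / 2 ^ T = (3/4) ^ T.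
  refine (expect_indicator_le_div _ _
    (fun l => 4 ^ l.countP (fun x => decide (x ∈ (Set.Icc a b)ᶜ))) (c := 2 ^ T)
    (by simp) (by simp) ?_).trans ?_
  · rintro l ⟨hl, hm⟩
    have h2 : l.length ≤ 2 * l.countP (fun x => decide (x ∈ (Set.Icc a b)ᶜ)) := by
      by_contra! h3
      exact hm (median_mem_Icc h3)
    calc (2 : ℝ≥0∞) ^ T ≤ 2 ^ (2 * l.countP (fun x => decide (x ∈ (Set.Icc a b)ᶜ))) := by
          rw [← hl]; exact pow_le_pow_right₀ (by norm_num) h2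
      _ = _ := by rw [pow_mul]; norm_num
  · calc _ ≤ ENNReal.ofReal ((3 / 2) ^ T) / 2 ^ T := by
          gcongr
          exact expect_four_pow_countP_le oracle p _ h T
      _ = ENNReal.ofReal ((3 / 4) ^ T) := by
          have : (2 : ℝ≥0∞) ^ T = ENNReal.ofReal (2 ^ T) := by
            rw [ENNReal.ofReal_pow (by norm_num)]; simp
          rw [this, ← ENNReal.ofReal_div_of_pos (by positivity), ← div_pow]
          norm_num
      _ ≤ ENNReal.ofReal (δ / 2) :=
          ENNReal.ofReal_le_ofReal (three_quarters_pow_batchCount_le hδ hδ2)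

end Median

/-! ### Second moments from exponential moments -/

section Variance

/-- The inequality is affine in `M`, so it follows from the case `M = 2` and the slope bound u ≤ 3/2
* 2 ^ u. Both come from the cubic Taylor bound for exp with log 2 ≥ 0.69. -/
lemma mul_add_sq_le_two_rpow {M u : ℝ} (hM : 2 ≤ M) (hu : 0 ≤ u) :
    M * u + u ^ 2 ≤ (3 / 2 * M + 1) * 2 ^ u := by
  have hlog : 0.69 * u ≤ Real.log 2 * u := by
    have := Real.log_two_gt_d9
    gcongr
    linarith
  have hexp : 1 + 0.69 * u + (0.69 * u) ^ 2 / 2 + (0.69 * u) ^ 3 / 6 ≤ (2 : ℝ) ^ u := by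
    rw [Real.rpow_def_of_pos (by norm_num)]
    refine le_trans ?_ (Real.exp_le_exp.2 hlog)
    have := Real.sum_le_exp_of_nonneg (x := 0.69 * u) (by positivity) 4
    simp only [Finset.sum_range_succ, Finset.sum_range_zero, Nat.factorial] at this
    norm_num at this ⊢
    linarith
  have hu3 : 0 ≤ u ^ 3 := by positivity
  have h1 : u ≤ 3 / 2 * 2 ^ u := by nlinarith
  have h2 : 2 * u + u ^ 2 ≤ 4 * 2 ^ u := by nlinarith [mul_nonneg hu (sq_nonneg (u - 1))]
  nlinarith

/-- If `z ≥ 1` has `𝔼 2 ^ z ≤ 2 ^ M` then `𝔼 z² ≤ (M + 2) (𝔼 z)²`. -/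
lemma sum_sq_le_of_sum_two_rpow_le {ι : Type*} (s : Finset ι) (w z : ι → ℝ) {M : ℝ} (hM : 2 ≤ M)
    (hw : ∀ i ∈ s, 0 ≤ w i) (hw1 : ∑ i ∈ s, w i = 1) (hz : ∀ i ∈ s, w i ≠ 0 → 1 ≤ z i)
    (hexp : ∑ i ∈ s, w i * 2 ^ z i ≤ 2 ^ M) :
    ∑ i ∈ s, w i * z i ^ 2 ≤ (M + 2) * (∑ i ∈ s, w i * z i) ^ 2 := by
  set K := 3 / 4 * M + 1 / 2
  -- The chord of z² over [1, M + 1] is (M + 2) z - (M + 1). Beyond M + 1, with u = z - (M + 1), the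
  -- excess over it is M u + u² ≤ 2 K 2 ^ u = K 2 ^ z / 2 ^ M.
  have hpt : ∀ i ∈ s, w i * z i ^ 2
      ≤ (M + 2) * (w i * z i) - (M + 1) * w i + K / 2 ^ M * (w i * 2 ^ z i) := by
    intro i hi
    by_cases h0 : w i = 0
    · simp [h0]
    have hz1 := hz i hi h0
    have hsplit : (2 : ℝ) ^ (z i - (M + 1)) * 2 = 2 ^ z i / 2 ^ M := by
      rw [Real.rpow_sub (by norm_num), Real.rpow_add (by norm_num), Real.rpow_one]
      field_simp
    have key : z i ^ 2 ≤ (M + 2) * z i - (M + 1) + K * (2 ^ z i / 2 ^ M) := by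
      rcases le_total (z i) (M + 1) with h | h
      · have : 0 ≤ K * ((2 : ℝ) ^ z i / 2 ^ M) := by positivity
        nlinarith
      · have := mul_add_sq_le_two_rpow hM (sub_nonneg.2 h)
        rw [← hsplit]
        simp only [K]
        nlinarith
    calc w i * z i ^ 2 ≤ w i * ((M + 2) * z i - (M + 1) + K * (2 ^ z i / 2 ^ M)) :=
          mul_le_mul_of_nonneg_left key (hw i hi)
      _ = _ := by ring
  have hsum := Finset.sum_le_sum hpt
  simp only [Finset.sum_add_distrib, Finset.sum_sub_distrib, ← Finset.mul_sum, hw1] at hsum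
  have hK : K / 2 ^ M * ∑ i ∈ s, w i * (2 : ℝ) ^ z i ≤ K := by
    calc _ ≤ K / 2 ^ M * (2 : ℝ) ^ M := by gcongr
      _ = K := by field_simp
  set h := ∑ i ∈ s, w i * z i
  simp only [K] at hK
  -- Since K - (M + 1) = -(M + 2) / 4, averaging gives (M + 2) (h - 1/4), and h - 1/4 ≤ h².
  nlinarith [sq_nonneg (h - 1 / 2)]

lemma sum_mul_sub_sq {ι : Type*} (s : Finset ι) (w z : ι → ℝ) (hw1 : ∑ i ∈ s, w i = 1) (b : ℝ) :
    ∑ i ∈ s, w i * (z i - b) ^ 2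
      = ∑ i ∈ s, w i * z i ^ 2 - 2 * b * ∑ i ∈ s, w i * z i + b ^ 2 := by
  have : ∀ i ∈ s, w i * (z i - b) ^ 2 = w i * z i ^ 2 - 2 * b * (w i * z i) + b ^ 2 * w i :=
    fun i _ => by ring
  rw [Finset.sum_congr rfl this]
  simp only [Finset.sum_add_distrib, Finset.sum_sub_distrib, ← Finset.mul_sum, hw1, mul_one]

end Variance

/-! ### Conditional sampling and Chebyshev's inequality -/

section Sampling

variable {Ω : Type*} {D : PMF Ω}

/-- The mass that `D` conditioned on `S` gives to `x ∈ S`, as a real number. -/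
noncomputable def condMass (D : PMF Ω) (S : Finset Ω) (x : Ω) : ℝ :=
  (D x).toReal / ∑ y ∈ S, (D y).toReal

/-- The self-information of `x` in bits. -/
noncomputable def selfInfo (D : PMF Ω) (x : Ω) : ℝ := Real.logb 2 (1 / (D x).toReal)

lemma sum_apply_ne_top (D : PMF Ω) (S : Finset Ω) : ∑ y ∈ S, D y ≠ ∞ :=
  ENNReal.sum_ne_top.2 fun x _ => D.apply_ne_top x

lemma toReal_sum (D : PMF Ω) (S : Finset Ω) :
    (∑ y ∈ S, D y).toReal = ∑ y ∈ S, (D y).toReal :=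
  ENNReal.toReal_sum fun x _ => D.apply_ne_top x

lemma sum_toReal_pos {S : Finset Ω} (hS : ∑ y ∈ S, D y ≠ 0) : 0 < ∑ y ∈ S, (D y).toReal := by
  rw [← toReal_sum]
  exact ENNReal.toReal_pos hS (sum_apply_ne_top D S)

lemma condMass_nonneg (D : PMF Ω) (S : Finset Ω) (x : Ω) : 0 ≤ condMass D S x :=
  div_nonneg ENNReal.toReal_nonneg (Finset.sum_nonneg fun _ _ => ENNReal.toReal_nonneg)

lemma sum_condMass {S : Finset Ω} (hS : ∑ y ∈ S, D y ≠ 0) : ∑ x ∈ S, condMass D S x = 1 := by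
  simp only [condMass, ← Finset.sum_div]
  exact div_self (sum_toReal_pos hS).ne'

lemma ofReal_condMass {S : Finset Ω} (hS : ∑ y ∈ S, D y ≠ 0) (x : Ω) :
    ENNReal.ofReal (condMass D S x) = D x / ∑ y ∈ S, D y := by
  rw [condMass, ← toReal_sum, ← ENNReal.toReal_div, ENNReal.ofReal_toReal]
  exact ENNReal.div_ne_top (D.apply_ne_top x) hS

lemma toReal_apply_le_one (D : PMF Ω) (x : Ω) : (D x).toReal ≤ 1 :=
  ENNReal.toReal_le_of_le_ofReal zero_le_one (by simpa using D.coe_le_one x)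

lemma selfInfo_nonneg (D : PMF Ω) (x : Ω) : 0 ≤ selfInfo D x := by
  rw [selfInfo, one_div, Real.logb_inv, neg_nonneg]
  exact Real.logb_nonpos (by norm_num) ENNReal.toReal_nonneg (toReal_apply_le_one D x)

/-- The mean of the self-information conditioned on `S`. -/
noncomputable def condMean (D : PMF Ω) (S : Finset Ω) : ℝ :=
  ∑ x ∈ S, condMass D S x * selfInfo D x

/-- The variance of the self-information conditioned on `S`. -/
noncomputable def condVar (D : PMF Ω) (S : Finset Ω) : ℝ :=
  ∑ x ∈ S, condMass D S x * (selfInfo D x - condMean D S) ^ 2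

lemma condVar_nonneg (D : PMF Ω) (S : Finset Ω) : 0 ≤ condVar D S :=
  Finset.sum_nonneg fun x _ => mul_nonneg (condMass_nonneg D S x) (sq_nonneg _)

variable [Fintype Ω] [DecidableEq Ω] {oracle : Finset Ω → PMF (Ω × ℝ)}

lemma expect_oracle (horacle : IsPROC D oracle) (S : Finset Ω)
    (hS : ∑ y ∈ S, D y ≠ 0) (f : Ω × ℝ → ℝ≥0∞) :
    expect (oracle S) f = ∑ x ∈ S, D x / (∑ y ∈ S, D y) * f (x, (D x).toReal) := by
  unfold expect
  rw [ENNReal.tsum_prod', tsum_fintype, ← Finset.sum_subset (Finset.subset_univ S)]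
  · refine Finset.sum_congr rfl fun x hx => ?_
    rw [tsum_eq_single (D x).toReal]
    · rw [horacle S hS, if_pos ⟨hx, rfl⟩]
    · intro r hr
      rw [horacle S hS, if_neg fun h => hr h.2, zero_mul]
  · intro x _ hx
    simp [horacle S hS, hx]

lemma expect_drawSelfInfo (horacle : IsPROC D oracle) (Sbar : Finset Ω)
    (hS : ∑ y ∈ Finset.univ \ Sbar, D y ≠ 0) {g : ℝ → ℝ} (hg : ∀ x, 0 ≤ g x) :
    expect ((drawSelfInfo Sbar).run oracle) (fun x => ENNReal.ofReal (g x))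
      = ENNReal.ofReal (∑ x ∈ Finset.univ \ Sbar,
          condMass D (Finset.univ \ Sbar) x * g (selfInfo D x)) := by
  simp only [drawSelfInfo, Program.run, expect_bind, expect_pure]
  rw [expect_oracle horacle _ hS,
    ENNReal.ofReal_sum_of_nonneg fun x _ => mul_nonneg (condMass_nonneg _ _ x) (hg _)]
  refine Finset.sum_congr rfl fun x _ => ?_
  rw [ENNReal.ofReal_mul (condMass_nonneg _ _ x), ofReal_condMass hS, selfInfo]

/-- Additivity of variance for independent draws. The free offset `b` lets the induction absorb the
first draw's deviation from the mean. -/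
lemma expect_repeated_drawSelfInfo_sq (horacle : IsPROC D oracle) (Sbar : Finset Ω)
    (hS : ∑ y ∈ Finset.univ \ Sbar, D y ≠ 0) (n : ℕ) (b : ℝ) :
    expect (((drawSelfInfo Sbar).repeated n).run oracle) (fun l =>
        ENNReal.ofReal ((l.sum + b - n * condMean D (Finset.univ \ Sbar)) ^ 2))
      = ENNReal.ofReal (n * condVar D (Finset.univ \ Sbar) + b ^ 2) := by
  set S := Finset.univ \ Sbar
  set μ := condMean D S
  induction n generalizing b with
  | zero => simp [Program.expect_run_repeated_zero]
  | succ n ih =>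
    rw [Program.expect_run_repeated_succ]
    have h1 : ∀ a : ℝ, (expect (((drawSelfInfo Sbar).repeated n).run oracle) fun l =>
        ENNReal.ofReal (((a :: l).sum + b - (n + 1 : ℕ) * μ) ^ 2))
        = ENNReal.ofReal (n * condVar D S + (a - (μ - b)) ^ 2) := by
      intro a
      rw [show a - (μ - b) = a - μ + b by ring, ← ih]
      congr 1
      funext l
      push_cast [List.sum_cons]
      ring_nf
    simp only [h1]
    rw [expect_drawSelfInfo horacle Sbar hS
      (g := fun a => n * condVar D S + (a - (μ - b)) ^ 2)
      fun x => add_nonneg (mul_nonneg n.cast_nonneg (condVar_nonneg _ _)) (sq_nonneg _)]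
    congr 1
    simp only [mul_add, Finset.sum_add_distrib, ← Finset.sum_mul]
    rw [sum_mul_sub_sq _ _ _ (sum_condMass hS)]
    have h2 : condVar D S = _ := sum_mul_sub_sq S _ (selfInfo D) (sum_condMass hS) μ
    have h3 : ∑ x ∈ S, condMass D S x * selfInfo D x = μ := rfl
    have h4 : ∑ x ∈ S, condMass D S x = 1 := sum_condMass hS
    rw [h3] at h2 ⊢
    rw [h4]
    push_cast
    linear_combination -h2

/-- Chebyshev's inequality for the mean of a batch. -/
lemma expect_batchMean_notMem_le (horacle : IsPROC D oracle) (Sbar : Finset Ω)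
    (hS : ∑ y ∈ Finset.univ \ Sbar, D y ≠ 0) {t : ℕ} {C ε : ℝ} (hε : 0 < ε) (hC : 0 < C)
    (hμ : 0 < condMean D (Finset.univ \ Sbar))
    (hV : condVar D (Finset.univ \ Sbar) ≤ C * condMean D (Finset.univ \ Sbar) ^ 2)
    (ht : 6 / ε ^ 2 * C ≤ t) :
    expect ((batchMean Sbar t).run oracle)
      ((Set.Icc ((1 - ε) * condMean D (Finset.univ \ Sbar))
        ((1 + ε) * condMean D (Finset.univ \ Sbar)))ᶜ.indicator 1) ≤ 1 / 6 := by
  set S := Finset.univ \ Sbar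
  set μ := condMean D S
  have ht0 : (0 : ℝ) < t := lt_of_lt_of_le (by positivity) ht
  rw [batchMean, Program.expect_run_bind_ret]
  have hsec := expect_repeated_drawSelfInfo_sq horacle Sbar hS t 0
  refine (expect_indicator_le_div _
    {l : List ℝ | l.sum / t ∈ (Set.Icc ((1 - ε) * μ) ((1 + ε) * μ))ᶜ}
    (fun l => ENNReal.ofReal ((l.sum + 0 - t * μ) ^ 2)) (c := ENNReal.ofReal ((t * (ε * μ)) ^ 2))
    (by rw [ne_eq, ENNReal.ofReal_eq_zero, not_le]; positivity) ENNReal.ofReal_ne_top ?_).trans ?_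
  · intro l hl
    apply ENNReal.ofReal_le_ofReal
    rw [add_zero, sq_le_sq, abs_of_pos (by positivity : 0 < t * (ε * μ))]
    have h1 : l.sum = t * (l.sum / t) := by field_simp
    have h2 : ε * μ ≤ |l.sum / t - μ| := by
      by_contra! h
      rw [abs_lt] at h
      exact hl ⟨by linarith, by linarith⟩
    rw [h1, ← mul_sub, abs_mul, abs_of_pos ht0]
    gcongr
  · rw [hsec, ← ENNReal.ofReal_div_of_pos (by positivity)]
    rw [show (1 / 6 : ℝ≥0∞) = ENNReal.ofReal (1 / 6) by
      rw [ENNReal.ofReal_div_of_pos (by norm_num)]; simp]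
    apply ENNReal.ofReal_le_ofReal
    rw [div_le_iff₀ (by positivity)]
    have h3 : 6 * C ≤ t * ε ^ 2 := by
      rw [div_mul_eq_mul_div, div_le_iff₀ (by positivity)] at ht
      exact ht
    have h4 : t * condVar D S ≤ t * (t * ε ^ 2 / 6 * μ ^ 2) := by
      gcongr
      refine hV.trans ?_
      gcongr
      linarith
    change t * condVar D S + 0 ^ 2 ≤ _
    nlinarith

lemma expect_sampleEst_notMem_le (horacle : IsPROC D oracle) (Sbar : Finset Ω)
    (hS : ∑ y ∈ Finset.univ \ Sbar, D y ≠ 0) {t : ℕ} {C ε δ : ℝ} (hε : 0 < ε) (hδ : 0 < δ)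
    (hδ2 : δ ≤ 2) (hC : 0 < C) (hμ : 0 < condMean D (Finset.univ \ Sbar))
    (hV : condVar D (Finset.univ \ Sbar) ≤ C * condMean D (Finset.univ \ Sbar) ^ 2)
    (ht : 6 / ε ^ 2 * C ≤ t) :
    expect ((sampleEst Sbar t δ).run oracle)
      ((Set.Icc ((1 - ε) * condMean D (Finset.univ \ Sbar))
        ((1 + ε) * condMean D (Finset.univ \ Sbar)))ᶜ.indicator 1) ≤ ENNReal.ofReal (δ / 2) :=
  expect_median_notMem_le oracle _ hδ hδ2
    (expect_batchMean_notMem_le horacle Sbar hS hε hC hμ hV ht)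

end Sampling

/-! ### Relative variance of the self-information -/

section EntropyBounds

variable {Ω : Type*} {D : PMF Ω}

/-- The factor 2 ^ `selfInfo` cancels the mass of x, so every point of positive mass contributes the
same amount and points of mass zero contribute nothing. -/
lemma condMass_mul_two_rpow_le {S : Finset Ω} (hS : ∑ y ∈ S, D y ≠ 0) (c : ℝ) (x : Ω) :
    condMass D S x * 2 ^ (selfInfo D x + c) ≤ 2 ^ c / ∑ y ∈ S, (D y).toReal := by
  have hP := sum_toReal_pos hS
  rcases eq_or_ne (D x).toReal 0 with h | h
  · rw [condMass, h, zero_div, zero_mul]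
    positivity
  · have hp : 0 < (D x).toReal := lt_of_le_of_ne ENNReal.toReal_nonneg h.symm
    rw [Real.rpow_add (by norm_num), selfInfo,
      Real.rpow_logb (by norm_num) (by norm_num) (by positivity), condMass]
    apply le_of_eq
    field_simp

/-- Variance is invariant under the shift by `c`, so the second-moment bound applies to `selfInfo +
c`. As `c ≤ 0`, undoing the shift only enlarges the mean. -/
lemma one_le_condMean_and_condVar_le {S : Finset Ω} (hS : ∑ y ∈ S, D y ≠ 0) {M c : ℝ}
    (hM : 2 ≤ M) (hc : c ≤ 0) (hz : ∀ x ∈ S, D x ≠ 0 → 1 ≤ selfInfo D x + c)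
    (hcard : S.card * (2 ^ c / ∑ y ∈ S, (D y).toReal) ≤ 2 ^ M) :
    1 ≤ condMean D S ∧ condVar D S ≤ (M + 1) * condMean D S ^ 2 := by
  have hz' : ∀ x ∈ S, condMass D S x ≠ 0 → 1 ≤ selfInfo D x + c := by
    refine fun x hx h => hz x hx fun h0 => h ?_
    simp [condMass, h0]
  have hsum := sum_condMass hS
  have hmean : ∑ x ∈ S, condMass D S x * (selfInfo D x + c) = condMean D S + c := by
    simp only [mul_add, Finset.sum_add_distrib, ← Finset.sum_mul, hsum, one_mul, condMean]
  have h1 : 1 ≤ condMean D S + c := by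
    rw [← hmean, ← hsum]
    refine Finset.sum_le_sum fun x hx => ?_
    by_cases h : condMass D S x = 0
    · simp [h]
    · exact le_mul_of_one_le_right (condMass_nonneg D S x) (hz' x hx h)
  have hexp : ∑ x ∈ S, condMass D S x * 2 ^ (selfInfo D x + c) ≤ 2 ^ M := by
    refine (Finset.sum_le_sum fun x _ => condMass_mul_two_rpow_le hS c x).trans ?_
    rwa [Finset.sum_const, nsmul_eq_mul]
  have h2 := sum_sq_le_of_sum_two_rpow_le S (condMass D S) (fun x => selfInfo D x + c) hM
    (fun x _ => condMass_nonneg D S x) hsum hz' hexp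
  have h3 := sum_mul_sub_sq S (condMass D S) (fun x => selfInfo D x + c) hsum (condMean D S + c)
  simp only [add_sub_add_right_eq_sub] at h3
  rw [hmean] at h2 h3
  refine ⟨by linarith, ?_⟩
  have h4 : condVar D S ≤ (M + 1) * (condMean D S + c) ^ 2 := by
    rw [condVar, h3]
    linarith
  refine h4.trans ?_
  gcongr
  linarith

variable [Fintype Ω]

lemma sum_univ_toReal (D : PMF Ω) : ∑ x, (D x).toReal = 1 := by
  rw [← toReal_sum, ← tsum_fintype (L := .unconditional Ω), D.tsum_coe, ENNReal.toReal_one]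

lemma condMean_univ (D : PMF Ω) : condMean D Finset.univ = entropy D := by
  simp only [condMean, entropy, condMass, sum_univ_toReal, div_one, selfInfo]

lemma two_rpow_bitLength (h : 2 ≤ bitLength Ω) : (2 : ℝ) ^ bitLength Ω = Fintype.card Ω := by
  have : (0 : ℝ) < Fintype.card Ω := by
    rw [Nat.cast_pos, Nat.pos_iff_ne_zero]
    intro h0
    rw [bitLength, h0] at h
    norm_num at h
  exact Real.rpow_logb (by norm_num) (by norm_num) this

lemma condMean_and_condVar_univ (hm : 2 ≤ bitLength Ω) (hD : ∀ x, (D x).toReal ≤ 1 / 2) :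
    1 ≤ condMean D Finset.univ ∧
      condVar D Finset.univ ≤ (bitLength Ω + 1) * condMean D Finset.univ ^ 2 := by
  have hS : ∑ y, D y ≠ 0 := by
    intro h
    have := sum_univ_toReal D
    rw [← toReal_sum, h] at this
    simp at this
  refine one_le_condMean_and_condVar_le hS hm le_rfl (fun x _ hx => ?_) ?_
  · have hp : 0 < (D x).toReal := ENNReal.toReal_pos hx (D.apply_ne_top x)
    rw [add_zero, selfInfo, Real.le_logb_iff_rpow_le (by norm_num) (by positivity),
      Real.rpow_one, le_div_iff₀ hp]
    linarith [hD x]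
  · rw [sum_univ_toReal, Real.rpow_zero, two_rpow_bitLength hm, Finset.card_univ]
    simp

variable [DecidableEq Ω]

lemma sum_compl_toReal (D : PMF Ω) (x : Ω) :
    ∑ y ∈ Finset.univ \ {x}, (D y).toReal = 1 - (D x).toReal := by
  rw [← sum_univ_toReal D, ← Finset.sum_sdiff (Finset.subset_univ {x}), Finset.sum_singleton]
  ring

/-- With P < 1/2 the remaining mass, the shift is c = log P + 1 = log (2 P) ≤ 0. Remaining masses
are at most P, so the shifted self-information is at least 1. Its exponential moment is at most 2
|Ω|, whence the exponent m + 1. -/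
lemma condMean_and_condVar_compl (hm : 2 ≤ bitLength Ω) {x : Ω} (hx : 1 / 2 < (D x).toReal)
    (hS : ∑ y ∈ Finset.univ \ {x}, D y ≠ 0) :
    1 ≤ condMean D (Finset.univ \ {x}) ∧ condVar D (Finset.univ \ {x})
      ≤ (bitLength Ω + 2) * condMean D (Finset.univ \ {x}) ^ 2 := by
  have hP := sum_toReal_pos hS
  rw [sum_compl_toReal] at hP
  set P := 1 - (D x).toReal with hPdef
  have hpow : (2 : ℝ) ^ (Real.logb 2 P + 1) = P * 2 := by
    rw [Real.rpow_add (by norm_num), Real.rpow_logb (by norm_num) (by norm_num) hP, Real.rpow_one]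
  have hc : Real.logb 2 P + 1 ≤ 0 := by
    by_contra! h
    have := Real.one_lt_rpow (x := (2 : ℝ)) (by norm_num) h
    rw [hpow] at this
    linarith
  rw [show bitLength Ω + 2 = bitLength Ω + 1 + 1 by ring]
  refine one_le_condMean_and_condVar_le hS (by linarith) hc (fun y hy hy0 => ?_) ?_
  · have hp : 0 < (D y).toReal := ENNReal.toReal_pos hy0 (D.apply_ne_top y)
    have hle : (D y).toReal ≤ P := by
      rw [hPdef, ← sum_compl_toReal]
      exact Finset.single_le_sum (f := fun y => (D y).toReal)
        (fun _ _ => ENNReal.toReal_nonneg) hy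
    have := Real.logb_le_logb_of_le (b := 2) (by norm_num) hp hle
    rw [selfInfo, one_div, Real.logb_inv]
    linarith
  · rw [sum_compl_toReal, hpow, mul_div_cancel_left₀ _ hP.ne', Real.rpow_add (by norm_num),
      two_rpow_bitLength hm, Real.rpow_one]
    gcongr
    exact Finset.card_le_univ _

lemma entropy_eq_add_condMean (D : PMF Ω) {x : Ω} (hS : ∑ y ∈ Finset.univ \ {x}, D y ≠ 0) :
    entropy D = (D x).toReal * selfInfo D x
      + (1 - (D x).toReal) * condMean D (Finset.univ \ {x}) := by
  have hP := sum_toReal_pos hS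
  have h1 : (1 - (D x).toReal) * condMean D (Finset.univ \ {x})
      = ∑ y ∈ Finset.univ \ {x}, (D y).toReal * selfInfo D y := by
    rw [← sum_compl_toReal, condMean, Finset.mul_sum]
    refine Finset.sum_congr rfl fun y _ => ?_
    rw [condMass]
    field_simp
  rw [h1, entropy, ← Finset.sum_sdiff (Finset.subset_univ {x}), Finset.sum_singleton, add_comm]
  rfl

lemma entropy_eq_zero_of_sum_compl_eq_zero {x : Ω} (hS : ∑ y ∈ Finset.univ \ {x}, D y = 0) :
    (D x).toReal = 1 ∧ entropy D = 0 := by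
  have h1 : (D x).toReal = 1 := by
    have := sum_compl_toReal D x
    rw [← toReal_sum, hS, ENNReal.toReal_zero] at this
    linarith
  refine ⟨h1, Finset.sum_eq_zero fun y _ => ?_⟩
  rcases eq_or_ne y x with rfl | hy
  · simp [h1]
  · have : D y = 0 := by
      rw [Finset.sum_eq_zero_iff] at hS
      exact hS y (by simpa using hy)
    simp [this]

end EntropyBounds

/-! ### Numerical estimates for the batch sizes and the query bound -/

section Numerics

lemma logb_two_le_sub_one {m : ℝ} (hm : 2 ≤ m) : Real.logb 2 m ≤ m - 1 := by
  rw [Real.logb_le_iff_le_rpow (by norm_num) (by linarith)]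
  have := one_add_mul_self_le_rpow_one_add (s := 1) (by norm_num) (p := m - 1) (by linarith)
  norm_num at this
  exact this

/-- Of the logarithmic terms in the batch sizes, accuracy needs only that they are at least 2: this
gives m + 1 in the light case and m + 2 in the heavy one. -/
lemma two_le_logb_add {m c : ℝ} (hm : 2 ≤ m) (hc : 1 ≤ c) :
    2 ≤ Real.logb 2 (m + Real.logb 2 m + c) := by
  have h1 : 1 ≤ Real.logb 2 m := by
    rw [Real.le_logb_iff_rpow_le (by norm_num) (by linarith)]
    simpa using hm
  rw [Real.le_logb_iff_rpow_le (by norm_num) (by linarith)]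
  norm_num
  linarith

lemma logb_add_le {m : ℝ} (hm : 2 ≤ m) :
    Real.logb 2 (m + Real.logb 2 m + 2.5) ≤ 5 / 4 * m := by
  have h1 : 1 ≤ Real.logb 2 m := by
    rw [Real.le_logb_iff_rpow_le (by norm_num) (by linarith)]
    simpa using hm
  have h2 := logb_two_le_sub_one hm
  have h3 : Real.logb 2 (11 / 4) ≤ 3 / 2 := by
    have : (2 : ℕ) * Real.logb 2 (11 / 4) ≤ 3 := by
      rw [← Real.logb_pow, Real.logb_le_iff_le_rpow (by norm_num) (by norm_num)]
      norm_num
    push_cast at this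
    linarith
  calc Real.logb 2 (m + Real.logb 2 m + 2.5) ≤ Real.logb 2 (11 / 4 * m) := by
        apply Real.logb_le_logb_of_le (by norm_num)
        · norm_num; linarith
        · norm_num; linarith
    _ = Real.logb 2 (11 / 4) + Real.logb 2 m := Real.logb_mul (by norm_num) (by linarith)
    _ ≤ 5 / 4 * m := by linarith

lemma query_bound_le {m ε δ : ℝ} (hm : 2 ≤ m) (hε : 0 < ε) (hε1 : ε ≤ 1) (hδ : 0 < δ)
    (hδ1 : δ ≤ 1 / 2) :
    ((⌈Real.logb 2 (10 / δ)⌉₊ + ⌈9 / 2 * Real.logb 2 (2 / (0.9 * δ))⌉₊ *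
      ⌈6 / ε ^ 2 * (m + Real.logb 2 (m + Real.logb 2 m + 2.5))⌉₊ : ℕ) : ℝ)
      ≤ 160 * (m / ε ^ 2 * Real.logb 2 (1 / δ)) := by
  set l := Real.logb 2 (1 / δ) with hl
  set A := m / ε ^ 2 with hA
  have hl1 : 1 ≤ l := by
    rw [hl, Real.le_logb_iff_rpow_le (by norm_num) (by positivity), Real.rpow_one,
      le_div_iff₀ hδ]
    linarith
  have hA2 : 2 ≤ A := by
    rw [hA, le_div_iff₀ (by positivity)]
    nlinarith
  have h10 : Real.logb 2 10 ≤ 10 / 3 := by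
    have : (3 : ℕ) * Real.logb 2 10 ≤ 10 := by
      rw [← Real.logb_pow, Real.logb_le_iff_le_rpow (by norm_num) (by norm_num)]
      norm_num
    push_cast at this
    linarith
  have h209 : Real.logb 2 (20 / 9) ≤ 6 / 5 := by
    have : (5 : ℕ) * Real.logb 2 (20 / 9) ≤ 6 := by
      rw [← Real.logb_pow, Real.logb_le_iff_le_rpow (by norm_num) (by norm_num)]
      norm_num
    push_cast at this
    linarith
  have e1 : Real.logb 2 (10 / δ) = Real.logb 2 10 + l := by
    rw [hl, ← Real.logb_mul (by norm_num) (by positivity), mul_one_div]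
  have e2 : Real.logb 2 (2 / (0.9 * δ)) = Real.logb 2 (20 / 9) + l := by
    rw [hl, ← Real.logb_mul (by norm_num) (by positivity)]
    congr 1
    field_simp
    norm_num
  have p10 : 0 ≤ Real.logb 2 10 := Real.logb_nonneg (by norm_num) (by norm_num)
  have p209 : 0 ≤ Real.logb 2 (20 / 9) := Real.logb_nonneg (by norm_num) (by norm_num)
  have p3 := two_le_logb_add hm (c := 2.5) (by norm_num)
  have b1 : (⌈Real.logb 2 (10 / δ)⌉₊ : ℝ) ≤ 16 / 3 * l := by
    refine (Nat.ceil_lt_add_one (by rw [e1]; linarith)).le.trans ?_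
    rw [e1]; linarith
  have b2 : (⌈9 / 2 * Real.logb 2 (2 / (0.9 * δ))⌉₊ : ℝ) ≤ 109 / 10 * l := by
    refine (Nat.ceil_lt_add_one (by rw [e2]; linarith)).le.trans ?_
    rw [e2]; linarith
  have b3 : (⌈6 / ε ^ 2 * (m + Real.logb 2 (m + Real.logb 2 m + 2.5))⌉₊ : ℝ) ≤ 14 * A := by
    refine (Nat.ceil_lt_add_one (mul_nonneg (by positivity) (by linarith))).le.trans ?_
    have : 6 / ε ^ 2 * (m + Real.logb 2 (m + Real.logb 2 m + 2.5)) ≤ 6 / ε ^ 2 * (9 / 4 * m) := by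
      gcongr
      linarith [logb_add_le hm]
    have e : 6 / ε ^ 2 * (9 / 4 * m) = 27 / 2 * A := by rw [hA]; ring
    linarith
  push_cast
  -- The product has constant 10.9 * 14 = 152.6, and `A ≥ 2` bounds the search term by 8/3 * (A *
  -- l).
  calc _ ≤ 16 / 3 * l + 109 / 10 * l * (14 * A) := by gcongr
    _ ≤ 160 * (A * l) := by nlinarith

end Numerics

/-! ### The search for a heavy element and the total failure probability -/

section Search

variable {Ω : Type*} [Fintype Ω] {D : PMF Ω}

lemma batchSizeLight_le_batchSizeHeavy (hm : 2 ≤ bitLength Ω) (ε : ℝ) :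
    batchSizeLight Ω ε ≤ batchSizeHeavy Ω ε := by
  have h := two_le_logb_add hm (c := 1.1) (by norm_num)
  have h1 : 0 ≤ Real.logb 2 (bitLength Ω) := Real.logb_nonneg (by norm_num) (by linarith)
  have h2 : Real.logb 2 (bitLength Ω + Real.logb 2 (bitLength Ω) + 1.1)
      ≤ Real.logb 2 (bitLength Ω + Real.logb 2 (bitLength Ω) + 2.5) :=
    Real.logb_le_logb_of_le (by norm_num) (by norm_num; linarith) (by norm_num)
  apply Nat.ceil_mono
  gcongr
  linarith

variable [DecidableEq Ω] {oracle : Finset Ω → PMF (Ω × ℝ)}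

/-- The interval of estimates with relative error at most `ε`. -/
noncomputable def accurate (D : PMF Ω) (ε : ℝ) : Set ℝ :=
  Set.Icc ((1 - ε) * entropy D) ((1 + ε) * entropy D)

lemma expect_sampleEst_empty_le (horacle : IsPROC D oracle) (hm : 2 ≤ bitLength Ω)
    (hD : ∀ x, (D x).toReal ≤ 1 / 2) {ε δ : ℝ} (hε : 0 < ε) (hδ : 0 < δ) (hδ2 : δ ≤ 2) :
    expect ((sampleEst ∅ (batchSizeLight Ω ε) δ).run oracle) ((accurate D ε)ᶜ.indicator 1)
      ≤ ENNReal.ofReal (δ / 2) := by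
  obtain ⟨h1, h2⟩ := condMean_and_condVar_univ hm hD
  have hl := two_le_logb_add hm (c := 1.1) (by norm_num)
  have hS : ∑ y, D y ≠ 0 := by
    rw [← tsum_fintype (L := .unconditional Ω), D.tsum_coe]
    exact one_ne_zero
  have := expect_sampleEst_notMem_le horacle ∅ (by rwa [Finset.sdiff_empty])
    (t := batchSizeLight Ω ε) (C := bitLength Ω + 1) hε hδ hδ2 (by linarith)
    (by rw [Finset.sdiff_empty]; linarith) (by rwa [Finset.sdiff_empty])
    (le_trans (by gcongr; linarith) (Nat.le_ceil _))
  rwa [Finset.sdiff_empty, condMean_univ] at this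

lemma expect_estimate_avoiding_le (horacle : IsPROC D oracle) (hm : 2 ≤ bitLength Ω) {x : Ω}
    (hx : 1 / 2 < (D x).toReal) {ε δ : ℝ} (hε : 0 < ε) (hδ : 0 < δ) (hδ2 : δ ≤ 2) :
    expect (((sampleEst {x} (batchSizeHeavy Ω ε) δ).bind fun h =>
        .ret ((1 - (D x).toReal) * h
          + (D x).toReal * Real.logb 2 (1 / (D x).toReal))).run oracle)
      ((accurate D ε)ᶜ.indicator 1) ≤ ENNReal.ofReal (δ / 2) := by
  rw [Program.expect_run_bind_ret]
  by_cases hS : ∑ y ∈ Finset.univ \ {x}, D y = 0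
  -- The oracle may now answer arbitrarily, but its estimate gets weight 1 - D x = 0 and the output
  -- is exactly the entropy 0.
  · obtain ⟨h1, h2⟩ := entropy_eq_zero_of_sum_compl_eq_zero hS
    simp [h1, h2, accurate, expect]
  · obtain ⟨h1, h2⟩ := condMean_and_condVar_compl hm hx hS
    have hl := two_le_logb_add hm (c := 2.5) (by norm_num)
    refine le_trans (expect_mono _ fun h => ?_) (expect_sampleEst_notMem_le horacle {x} hS
      (t := batchSizeHeavy Ω ε) (C := bitLength Ω + 2) hε hδ hδ2 (by linarith) (by linarith) h2
      (le_trans (by gcongr) (Nat.le_ceil _)))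
    by_cases hh : h ∈ Set.Icc ((1 - ε) * condMean D (Finset.univ \ {x}))
        ((1 + ε) * condMean D (Finset.univ \ {x}))
    · have hin : (1 - (D x).toReal) * h + (D x).toReal * Real.logb 2 (1 / (D x).toReal)
          ∈ accurate D ε := by
        have hr : 0 ≤ (D x).toReal * selfInfo D x :=
          mul_nonneg ENNReal.toReal_nonneg (selfInfo_nonneg D x)
        have hP : 0 ≤ 1 - (D x).toReal := by linarith [toReal_apply_le_one D x]
        have a1 := mul_le_mul_of_nonneg_left hh.1 hP
        have a2 := mul_le_mul_of_nonneg_left hh.2 hP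
        have a3 := mul_nonneg hε.le hr
        rw [accurate, entropy_eq_add_condMean D hS]
        change (1 - (D x).toReal) * h + (D x).toReal * selfInfo D x ∈ _
        constructor <;> linarith
      rw [Set.indicator_of_notMem (by simpa using hin)]
      exact zero_le
    · rw [Set.indicator_of_mem (s := (Set.Icc _ _)ᶜ) hh]
      exact Set.indicator_le_self' (f := (1 : ℝ → ℝ≥0∞)) (fun _ _ => zero_le) _

lemma expect_searchLoop_succ (horacle : IsPROC D oracle) (ε δ : ℝ) (k : ℕ) (f : ℝ → ℝ≥0∞) :
    expect ((searchLoop ε δ (k + 1)).run oracle) f = ∑ x, D x *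
      if 1 / 2 < (D x).toReal then
        expect (((sampleEst {x} (batchSizeHeavy Ω ε) (0.9 * δ)).bind fun h =>
          .ret ((1 - (D x).toReal) * h
            + (D x).toReal * Real.logb 2 (1 / (D x).toReal))).run oracle) f
      else expect ((searchLoop ε δ k).run oracle) f := by
  have hS : ∑ y, D y = 1 := by rw [← tsum_fintype (L := .unconditional Ω), D.tsum_coe]
  rw [searchLoop, Program.run, expect_bind, expect_oracle horacle _ (by rw [hS]; exact one_ne_zero)]
  refine Finset.sum_congr rfl fun x _ => ?_
  rw [hS, div_one]
  congr 1
  dsimp only [gt_iff_lt]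
  split_ifs <;> rfl

/-- Revealed masses are exact, so no search round can stop and the failure probability is that of
the final estimate. -/
lemma expect_searchLoop_le_of_light (horacle : IsPROC D oracle) (hm : 2 ≤ bitLength Ω)
    (hD : ∀ x, (D x).toReal ≤ 1 / 2) {ε δ : ℝ} (hε : 0 < ε) (hδ : 0 < δ) (hδ2 : δ ≤ 2) (k : ℕ) :
    expect ((searchLoop ε δ k).run oracle) ((accurate D ε)ᶜ.indicator 1)
      ≤ ENNReal.ofReal (0.9 * δ / 2) := by
  induction k with
  | zero => exact expect_sampleEst_empty_le horacle hm hD hε (by positivity) (by linarith)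
  | succ k ih =>
    rw [expect_searchLoop_succ horacle]
    simp only [(hD _).not_gt, if_false]
    rwa [← Finset.sum_mul, ← tsum_fintype (L := .unconditional Ω), D.tsum_coe, one_mul]

/-- Each round misses `x₀` with probability below 1/2, and only then does the remaining search
matter. With no rounds left the bound is at least 1, so nothing is required of the fallback
estimate. -/
lemma expect_searchLoop_le_of_heavy (horacle : IsPROC D oracle) (hm : 2 ≤ bitLength Ω) {x₀ : Ω}
    (hx₀ : 1 / 2 < (D x₀).toReal) {ε δ : ℝ} (hε : 0 < ε) (hδ : 0 < δ) (hδ2 : δ ≤ 2) (k : ℕ) :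
    expect ((searchLoop ε δ k).run oracle) ((accurate D ε)ᶜ.indicator 1)
      ≤ ENNReal.ofReal (0.9 * δ / 2 + (1 / 2) ^ k) := by
  induction k with
  | zero =>
    refine (expect_indicator_le_one _ _).trans ?_
    rw [ENNReal.one_le_ofReal]
    norm_num
    positivity
  | succ k ih =>
    rw [expect_searchLoop_succ horacle]
    have hterm : ∀ x ∈ Finset.univ, (D x * if 1 / 2 < (D x).toReal then
        expect (((sampleEst {x} (batchSizeHeavy Ω ε) (0.9 * δ)).bind fun h =>
          .ret ((1 - (D x).toReal) * h
            + (D x).toReal * Real.logb 2 (1 / (D x).toReal))).run oracle)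
          ((accurate D ε)ᶜ.indicator 1)
        else expect ((searchLoop ε δ k).run oracle) ((accurate D ε)ᶜ.indicator 1))
        ≤ ENNReal.ofReal ((D x).toReal * (0.9 * δ / 2)
          + if x = x₀ then 0 else (D x).toReal * (1 / 2) ^ k) := by
      intro x _
      nth_rewrite 1 [← ENNReal.ofReal_toReal (D.apply_ne_top x)]
      have hp : 0 ≤ (D x).toReal := ENNReal.toReal_nonneg
      split_ifs with h1 h2 h2
      · rw [add_zero, ENNReal.ofReal_mul hp]
        gcongr
        exact expect_estimate_avoiding_le horacle hm h1 hε (by positivity) (by linarith)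
      -- Two points of mass above 1/2 cannot coexist, but the bound holds here without using that.
      · rw [← mul_add, ENNReal.ofReal_mul hp]
        gcongr
        refine (expect_estimate_avoiding_le horacle hm h1 hε (by positivity)
          (by linarith)).trans (ENNReal.ofReal_le_ofReal ?_)
        exact le_add_of_nonneg_right (by positivity)
      · exact absurd (h2 ▸ hx₀) h1
      · rw [← mul_add, ENNReal.ofReal_mul hp]
        gcongr
    refine (Finset.sum_le_sum hterm).trans ?_
    rw [← ENNReal.ofReal_sum_of_nonneg fun x _ => add_nonneg (by positivity) (by positivity)]
    apply ENNReal.ofReal_le_ofReal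
    have hsplit : ∑ x, (if x = x₀ then 0 else (D x).toReal * (1 / 2 : ℝ) ^ k)
        = (1 - (D x₀).toReal) * (1 / 2) ^ k := by
      rw [← sum_compl_toReal, Finset.sum_mul, ← Finset.sum_sdiff (Finset.subset_univ {x₀}),
        Finset.sum_singleton, if_pos rfl, add_zero]
      refine Finset.sum_congr rfl fun x hx => if_neg ?_
      simpa using hx
    rw [Finset.sum_add_distrib, hsplit, ← Finset.sum_mul, sum_univ_toReal, one_mul, pow_succ']
    gcongr
    linarith

lemma half_pow_searchRounds_le {δ : ℝ} (hδ : 0 < δ) : (1 / 2 : ℝ) ^ searchRounds δ ≤ δ / 10 := by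
  calc (1 / 2 : ℝ) ^ searchRounds δ = (1 / 2 : ℝ) ^ (searchRounds δ : ℝ) := by
        rw [Real.rpow_natCast]
    _ ≤ (1 / 2 : ℝ) ^ Real.logb 2 (10 / δ) :=
        Real.rpow_le_rpow_of_exponent_ge (by norm_num) (by norm_num) (Nat.le_ceil _)
    _ = δ / 10 := by
        rw [one_div, Real.inv_rpow (by norm_num), Real.rpow_logb (by norm_num) (by norm_num)
          (by positivity), inv_div]

lemma expect_entropyEstimation_le (horacle : IsPROC D oracle) (hm : 2 ≤ bitLength Ω)
    {ε δ : ℝ} (hε : 0 < ε) (hδ : 0 < δ) :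
    expect ((entropyEstimation Ω ε δ).run oracle) ((accurate D ε)ᶜ.indicator 1)
      ≤ ENNReal.ofReal δ := by
  rcases le_or_gt 1 δ with h | h
  · exact (expect_indicator_le_one _ _).trans (ENNReal.one_le_ofReal.2 h)
  by_cases hD : ∀ x, (D x).toReal ≤ 1 / 2
  · exact (expect_searchLoop_le_of_light horacle hm hD hε hδ (by linarith) _).trans
      (ENNReal.ofReal_le_ofReal (by linarith))
  · push Not at hD
    obtain ⟨x₀, hx₀⟩ := hD
    refine (expect_searchLoop_le_of_heavy horacle hm hx₀ hε hδ (by linarith) _).trans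
      (ENNReal.ofReal_le_ofReal ?_)
    -- 0.45 δ for the estimate plus 0.1 δ for the search.
    linarith [half_pow_searchRounds_le hδ]

end Search

end EntropyEst

theorem theorem1 {Ω : Type*} [Fintype Ω] [DecidableEq Ω] (D : PMF Ω)
    (oracle : Finset Ω → PMF (Ω × ℝ)) (horacle : EntropyEst.IsPROC D oracle)
    (m : ℝ) (hm : m = Real.logb 2 (Fintype.card Ω)) (hm2 : 2 ≤ m)
    (ε δ : ℝ) (hε : 0 < ε) (hδ : 0 < δ) :
    -- accuracy
    ((EntropyEst.entropyEstimation Ω ε δ).run oracle).toMeasure.real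
        (Set.Icc ((1 - ε) * EntropyEst.entropy D) ((1 + ε) * EntropyEst.entropy D)) ≥ 1 - δ ∧
    -- worst-case number of queries, with the explicit constants
    (EntropyEst.entropyEstimation Ω ε δ).QueriesAtMost
        (⌈Real.logb 2 (10 / δ)⌉₊ + ⌈9 / 2 * Real.logb 2 (2 / (0.9 * δ))⌉₊ *
          ⌈6 / ε ^ 2 * (m + Real.logb 2 (m + Real.logb 2 m + 2.5))⌉₊) ∧
    -- hence `O((m / ε²) log (1 / δ))` queries
    (ε ≤ 1 → δ ≤ 1 / 2 → ∃ q : ℕ, (EntropyEst.entropyEstimation Ω ε δ).QueriesAtMost q ∧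
        (q : ℝ) ≤ 160 * (m / ε ^ 2 * Real.logb 2 (1 / δ))) := by
  subst hm
  have hq := EntropyEst.searchLoop_queriesAtMost ε δ
    (EntropyEst.batchSizeLight_le_batchSizeHeavy hm2 ε) (EntropyEst.searchRounds δ)
  exact ⟨EntropyEst.toMeasure_real_ge_of_expect_le _ measurableSet_Icc hδ.le
    (EntropyEst.expect_entropyEstimation_le horacle hm2 hε hδ), hq,
    fun hε1 hδ1 => ⟨_, hq, EntropyEst.query_bound_le hm2 hε hε1 hδ hδ1⟩⟩
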